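/- Let $F=\mathbb{F}_q$ be the finite field with $q$ elements and let $n,d,\ell$ be integers with $1\le d\le n-1$ and $\ell\ge 1$. For a nonzero homogeneous polynomial $h\in F[x_1,\dots,x_d]$, let $\mathcal{P}_h$ be the set of all polynomials in $F[x_1,\dots,x_d]$ whose homogeneous part of highest degree equals $h$. A set $S\subset F^n$ is called an $(n,d)$-BRK-type set of degree $\ell$ if there exist nonzero homogeneous polynomials $h_1,\dots,h_{n-d}\in F[x_1,\dots,x_d]$ of degree $\ell$ such that for every $\rho=(\rho_1,\dots,\rho_{n-d})\in F^{n-d}$ there exist $a_\rho\in F^n$ and polynomials $g_{\rho,i}\in\mathcal{P}_{h_i}$ $(1\le i\le n-d)$ with \[\{a_\rho+(t,\rho_1g_{\rho,1}(t),\dots,\rho_{n-d}\,g_{\rho,n-d}(t)) : t\in F^d\}\subset S.\] **Theorem.** Every $(n,d)$-BRK-type set $S\subset\mathbb{F}_q^n$ of degree $\ell\ge 1$ satisfies \[|S|\ \ge\ \frac{(q-1)^n}{(\ell+1-2\ell/q)^n}.\] -/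

import Mathlib

/-- `polysWithTop h` is the set `P_h` of all polynomials whose homogeneous part of highest degree
equals `h`. -/
def polysWithTop {σ F : Type*} [CommSemiring F] (h : MvPolynomial σ F) :
    Set (MvPolynomial σ F) :=
  {g | MvPolynomial.homogeneousComponent g.totalDegree g = h}

/-- The point `Γ(t) = a + (t, ρ₁ g₁(t), …, ρ_{n-d} g_{n-d}(t))` of `F ^ n`, where `t ∈ F ^ d`:
the first `d` coordinates of the second summand are those of `t`, the last `n - d` are the
`ρᵢ gᵢ(t)`. -/
noncomputable def brkPoint {F : Type*} [CommSemiring F] {n d : ℕ} (a : Fin n → F)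
    (ρ : Fin (n - d) → F) (g : Fin (n - d) → MvPolynomial (Fin d) F) (t : Fin d → F) :
    Fin n → F :=
  a + fun j : Fin n =>
    if hj : (j : ℕ) < d then t ⟨j, hj⟩
    else ρ ⟨j - d, by omega⟩ * MvPolynomial.eval t (g ⟨j - d, by omega⟩)

/-- `S ⊆ F ^ n` is an `(n, d)`-BRK-type set of degree `ℓ`. A homogeneous polynomial of degree `ℓ`
is in particular nonzero here, as it has to be the part of degree `ℓ` of polynomials of
degree `ℓ`. -/
def IsBRKType {F : Type*} [CommSemiring F] (n d ℓ : ℕ) (S : Set (Fin n → F)) : Prop :=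
  ∃ h : Fin (n - d) → MvPolynomial (Fin d) F,
    (∀ i, (h i).IsHomogeneous ℓ ∧ h i ≠ 0) ∧
    ∀ ρ : Fin (n - d) → F, ∃ a : Fin n → F, ∃ g : Fin (n - d) → MvPolynomial (Fin d) F,
      (∀ i, g i ∈ polysWithTop (h i)) ∧ Set.range (brkPoint a ρ g) ⊆ S

/-! Method of multiplicities; order at least `m` at `s` is encoded as `translate s P ∈ idealOfVars _
F ^ m`. Put `M = qℓ + q - ℓ` with `ℓ ≤ q`. If `S` is too small, linear algebra gives a nonzero `P`
of degree below `q²k` vanishing to order `Mk` on `S`.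

Give the `n - d` graph variables `y` weight `ℓ`, the `d` variables `x` weight 1, and let `Q` be the
top weighted form of `P`. Under `(y, x) ↦ a + (y + ρ g(x), x)` the top form becomes `Q(y + ρ h(x),
x)`, which involves neither `a` nor the lower terms of `g`. So `ρ` can be fixed before the graph is
known. Schwartz–Zippel with multiplicities, over `F[x]` to choose `ρ` and over `F` to choose `t`,
gives a graph point where the order of `P` is at most `M deg P / q² < Mk`
(`exists_forall_graph_multiplicity_le`), a contradiction.

Counting monomials and letting `k → ∞` yields `q ^ (2n) ≤ |S| M ^ n`, which implies the claim. For
`ℓ ≥ q` the claimed bound is at most 1. -/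

namespace MvPolynomial

/-! ### Translations and Schwartz–Zippel with multiplicities -/

/-- The translate `p(X + a)` of a polynomial `p`. -/
noncomputable def translate {σ R : Type*} [CommRing R] (a : σ → R) :
    MvPolynomial σ R →ₐ[R] MvPolynomial σ R :=
  aeval fun i => X i + C (a i)

@[simp]
theorem translate_X {σ R : Type*} [CommRing R] (a : σ → R) (i : σ) :
    translate a (X i) = X i + C (a i) := by
  simp [translate]

@[simp]
theorem translate_C {σ R : Type*} [CommRing R] (a : σ → R) (r : R) :
    translate a (C r) = C r :=
  (translate a).commutes r

theorem finSuccEquiv_translate {R : Type*} [CommRing R] {n : ℕ} (a : Fin (n + 1) → R)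
    (f : MvPolynomial (Fin (n + 1)) R) :
    finSuccEquiv R n (translate a f) =
      Polynomial.taylor (C (a 0))
        ((finSuccEquiv R n f).map (translate (Fin.tail a) : _ →ₐ[R] _).toRingHom) := by
  have hC : ∀ r : R, finSuccEquiv R n (C r) = Polynomial.C (C r) := fun r => by
    simp [finSuccEquiv_apply]
  let E : MvPolynomial (Fin (n + 1)) R →+* Polynomial (MvPolynomial (Fin n) R) :=
    RingHomClass.toRingHom (finSuccEquiv R n)
  have h : E.comp (translate a).toRingHom =
      ((Polynomial.taylorAlgHom (R := MvPolynomial (Fin n) R) (C (a 0))).toRingHom.comp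
        (Polynomial.mapRingHom (translate (Fin.tail a)).toRingHom)).comp E := by
    refine ringHom_ext (fun r => ?_) fun i => Fin.cases ?_ (fun j => ?_) i
    · simp [E, hC]
    · simp [E, finSuccEquiv_X_zero, hC]
    · simp [E, finSuccEquiv_X_succ, hC, Fin.tail]
  exact DFunLike.congr_fun h f

end MvPolynomial

namespace Polynomial

/-- Writing `g = (X - a)^k h`, the shift turns the first factor into `X^k`, so the coefficient is
`h(a) ≠ 0`. -/
theorem coeff_taylor_rootMultiplicity_ne_zero {R : Type*} [CommRing R] [IsDomain R]
    {g : Polynomial R} (hg : g ≠ 0) (a : R) :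
    (taylor a g).coeff (g.rootMultiplicity a) ≠ 0 := by
  obtain ⟨h, hgh, hdvd⟩ := exists_eq_pow_rootMultiplicity_mul_and_not_dvd g hg a
  set k := g.rootMultiplicity a
  rw [hgh, taylor_mul, taylor_pow]
  have : taylor a (X - C a) = X := by simp
  rw [this, coeff_X_pow_mul', if_pos le_rfl, Nat.sub_self, taylor_coeff_zero]
  exact fun h0 => hdvd (dvd_iff_isRoot.2 h0)

theorem exists_card_mul_rootMultiplicity_le {R : Type*} [CommRing R] [IsDomain R]
    {A : Finset R} (hA : A.Nonempty) (g : Polynomial R) :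
    ∃ a ∈ A, A.card * g.rootMultiplicity a ≤ g.natDegree := by
  classical
  by_contra! hlt
  have h1 : A.card * g.natDegree < ∑ a ∈ A, A.card * g.rootMultiplicity a := by
    rw [← smul_eq_mul, ← Finset.sum_const]
    exact Finset.sum_lt_sum_of_nonempty hA hlt
  rw [← Finset.mul_sum] at h1
  have h2 : ∑ a ∈ A, g.rootMultiplicity a ≤ g.roots.card := by
    simp_rw [← count_roots]
    calc ∑ a ∈ A, g.roots.count a = ∑ a ∈ A, (g.roots.filter (· ∈ A)).count a :=
          Finset.sum_congr rfl fun a ha => (Multiset.count_filter_of_pos ha).symm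
      _ = (g.roots.filter (· ∈ A)).card :=
          Multiset.sum_count_eq_card fun a ha => (Multiset.mem_filter.1 ha).2
      _ ≤ g.roots.card := Multiset.card_le_card (Multiset.filter_le _ _)
  have h3 := Nat.mul_le_mul_left A.card (h2.trans g.card_roots')
  omega

/-- The polynomial obtained by applying a linear functional to the coefficients commutes with
translation by elements of the base ring. -/
theorem exists_coeff_taylor_algebraMap {R B : Type*} [CommRing R] [CommRing B] [Algebra R B]
    (φ : B →ₗ[R] R) (G : Polynomial B) :
    ∃ g : Polynomial R, (∀ i, g.coeff i = φ (G.coeff i)) ∧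
      ∀ a j, (taylor a g).coeff j = φ ((taylor (algebraMap R B a) G).coeff j) := by
  let Φ : Polynomial B →ₗ[R] Polynomial R := lsum fun i => (monomial i).comp φ
  have hΦ : ∀ i b, Φ (monomial i b) = monomial i (φ b) := by
    intro i b
    simp [Φ, lsum_apply]
  refine ⟨Φ G, fun i => ?_, fun a j => ?_⟩
  · induction G using Polynomial.induction_on' with
    | add p q hp hq => simp [hp, hq]
    | monomial k b => rw [hΦ, coeff_monomial, coeff_monomial]; split_ifs <;> simp
  · induction G using Polynomial.induction_on' with
    | add p q hp hq => simp [hp, hq]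
    | monomial k b =>
      rw [hΦ, taylor_coeff, taylor_coeff, hasseDeriv_monomial, hasseDeriv_monomial,
        eval_monomial, eval_monomial, ← map_pow, mul_comm _ (algebraMap R B _),
        ← Algebra.smul_def, map_smul, ← nsmul_eq_mul, ← nsmul_eq_mul, map_nsmul, smul_eq_mul,
        mul_comm]

end Polynomial

namespace MvPolynomial

theorem coeff_translate_cons {R : Type*} [CommRing R] {n : ℕ} (a : Fin (n + 1) → R)
    (f : MvPolynomial (Fin (n + 1)) R) (j : ℕ) (β : Fin n →₀ ℕ) :
    coeff (β.cons j) (translate a f) =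
      coeff β ((Polynomial.taylor (C (a 0)) ((finSuccEquiv R n f).map
        (translate (Fin.tail a) : _ →ₐ[R] _).toRingHom)).coeff j) := by
  rw [← finSuccEquiv_translate, finSuccEquiv_coeff_coeff]

/-- **Schwartz–Zippel lemma with multiplicities**: a nonzero polynomial `f` has at some point of
the grid `A ^ n` a multiplicity of at most `deg f / |A|`. -/
theorem exists_coeff_translate_ne_zero {R : Type*} [CommRing R] [IsDomain R] {A : Finset R}
    (hA : A.Nonempty) {n : ℕ} {f : MvPolynomial (Fin n) R} (hf : f ≠ 0) :
    ∃ a : Fin n → R, (∀ i, a i ∈ A) ∧ ∃ β, coeff β (translate a f) ≠ 0 ∧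
      A.card * β.degree ≤ f.totalDegree := by
  induction n with
  | zero =>
    refine ⟨0, fun i => i.elim0, ?_⟩
    obtain ⟨β, hβ⟩ := ne_zero_iff.1 hf
    have h : translate (0 : Fin 0 → R) f = f := by simp [translate]
    refine ⟨β, by rwa [h], ?_⟩
    simp [Subsingleton.elim β 0]
  | succ n ih =>
    set G := finSuccEquiv R n f with hG
    have hG0 : G ≠ 0 := by simpa [hG] using hf
    have hlead : G.coeff G.natDegree ≠ 0 := by simpa using hG0
    -- Induct on the leading coefficient in the first variable; the univariate `g` below collects
    -- the `β'`-coefficients at `a'` and is nonzero because its coefficient at `G.natDegree` is.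
    obtain ⟨a', ha', β', hβ', hdeg'⟩ := ih hlead
    obtain ⟨g, hg, hgt⟩ := Polynomial.exists_coeff_taylor_algebraMap
      (lcoeff R β') (G.map (translate a' : _ →ₐ[R] _).toRingHom)
    have hgdeg : g.natDegree ≤ G.natDegree := by
      refine Polynomial.natDegree_le_iff_coeff_eq_zero.2 fun N hN => ?_
      rw [hg, Polynomial.coeff_map, Polynomial.coeff_eq_zero_of_natDegree_lt hN]
      simp
    have hg0 : g ≠ 0 := by
      intro h0
      have := hg G.natDegree
      rw [h0, Polynomial.coeff_map] at this
      exact hβ' (by simpa using this.symm)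
    obtain ⟨a, ha, hmul⟩ := Polynomial.exists_card_mul_rootMultiplicity_le hA g
    refine ⟨Fin.cons a a', fun i => Fin.cases (by simpa using ha) (by simpa using ha') i,
      β'.cons (g.rootMultiplicity a), ?_, ?_⟩
    · rw [coeff_translate_cons, Fin.cons_zero, Fin.tail_cons]
      have := hgt a (g.rootMultiplicity a)
      rw [algebraMap_eq, lcoeff_apply] at this
      rw [← hG, ← this]
      exact Polynomial.coeff_taylor_rootMultiplicity_ne_zero hg0 a
    · have h1 := totalDegree_coeff_finSuccEquiv_add_le f G.natDegree hlead
      have h2 : (β'.cons (g.rootMultiplicity a)).degree = g.rootMultiplicity a + β'.degree := by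
        simp [Finsupp.degree_eq_sum, Fin.sum_univ_succ]
      rw [h2, mul_add]
      change A.card * β'.degree ≤ totalDegree (G.coeff G.natDegree) at hdeg'
      change totalDegree (G.coeff G.natDegree) + _ ≤ _ at h1
      omega

end MvPolynomial

/-! ### Counting monomials and interpolation -/

theorem Finsupp.card_degree_lt {σ : Type*} [Fintype σ] (D : ℕ) :
    (Finsupp.finite_of_degree_lt (σ := σ) D).toFinset.card =
      ∑ k ∈ Finset.range D, (Fintype.card σ).multichoose k := by
  classical
  have h : (Finsupp.finite_of_degree_lt (σ := σ) D).toFinset =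
      (Finset.range D).biUnion fun k => (Finset.univ : Finset σ).finsuppAntidiag k := by
    ext e
    simp [Finset.mem_finsuppAntidiag, Finsupp.degree_eq_sum]
  rw [h, Finset.card_biUnion]
  · simp [Finset.card_finsuppAntidiag_nat_eq_multichoose]
  · intro i _ j _ hij
    rw [Function.onFun, Finset.disjoint_left]
    intro e he he'
    rw [Finset.mem_finsuppAntidiag] at he he'
    exact hij (he.1.symm.trans he'.1)

theorem Finsupp.factorial_mul_card_degree_lt {σ : Type*} [Fintype σ] (D : ℕ) :
    (Fintype.card σ).factorial * (Finsupp.finite_of_degree_lt (σ := σ) (D + 1)).toFinset.card =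
      (D + 1).ascFactorial (Fintype.card σ) := by
  rw [Finsupp.card_degree_lt, Nat.ascFactorial_eq_factorial_mul_choose,
    Nat.sum_range_multichoose]

namespace MvPolynomial

/-- Vanishing to order `m` at a point is one linear condition per monomial of degree below `m`, so
there are more unknown coefficients than conditions. -/
theorem exists_ne_zero_translate_mem_pow_idealOfVars {σ F : Type*} [Fintype σ] [Field F]
    (S : Finset (σ → F)) (D m : ℕ)
    (h : S.card * (Finsupp.finite_of_degree_lt (σ := σ) m).toFinset.card <
      (Finsupp.finite_of_degree_lt (σ := σ) D).toFinset.card) :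
    ∃ P : MvPolynomial σ F, P ≠ 0 ∧ P.totalDegree < D ∧
      ∀ s ∈ S, translate s P ∈ idealOfVars σ F ^ m := by
  classical
  set E := (Finsupp.finite_of_degree_lt (σ := σ) D).toFinset with hE
  set E' := (Finsupp.finite_of_degree_lt (σ := σ) m).toFinset with hE'
  let T : (E → F) →ₗ[F] MvPolynomial σ F := ∑ e : E, (monomial e.1).comp (LinearMap.proj e)
  have hT : ∀ c, T c = ∑ e : E, monomial e.1 (c e) := fun c => by simp [T]
  have hTc : ∀ c (e : E), coeff e.1 (T c) = c e := fun c e => by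
    simp [hT, coeff_sum, coeff_monomial]
  let L : (E → F) →ₗ[F] (S × E' → F) := LinearMap.pi fun x =>
    (lcoeff F x.2.1).comp ((translate x.1.1).toLinearMap.comp T)
  have hker : LinearMap.ker L ≠ ⊥ := by
    apply L.ker_ne_bot_of_finrank_lt
    simpa [Module.finrank_fintype_fun_eq_card] using h
  obtain ⟨c, hc, hc0⟩ := (Submodule.ne_bot_iff _).1 hker
  have hP0 : T c ≠ 0 := by
    intro h0
    apply hc0
    ext e
    rw [← hTc c e, h0, coeff_zero, Pi.zero_apply]
  have hsupp : ∀ e ∈ (T c).support, e.degree < D := by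
    intro e he
    by_contra hlt
    refine (mem_support_iff.1 he) ?_
    rw [hT, coeff_sum]
    refine Finset.sum_eq_zero fun e' _ => ?_
    rw [coeff_monomial, if_neg]
    rintro rfl
    exact hlt ((Set.Finite.mem_toFinset (Finsupp.finite_of_degree_lt D)).1 e'.2)
  refine ⟨T c, hP0, ?_, fun s hs => ?_⟩
  · obtain ⟨e, he⟩ := ne_zero_iff.1 hP0
    have hD : 0 < D := (Nat.zero_le _).trans_lt (hsupp e (mem_support_iff.2 he))
    rw [totalDegree, Finset.sup_lt_iff (by simpa using hD)]
    exact hsupp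
  · rw [mem_pow_idealOfVars_iff']
    intro e he
    have := congrFun (LinearMap.mem_ker.1 hc) (⟨s, hs⟩, ⟨e, by simpa [hE'] using he⟩)
    simpa [L] using this

end MvPolynomial

/-! ### Multiplicities under substitution -/

namespace MvPolynomial

section Order

variable {σ τ F : Type*} [CommRing F]

theorem constantCoeff_translate (a : σ → F) (p : MvPolynomial σ F) :
    constantCoeff (translate a p) = eval a p := by
  have h : (constantCoeff : MvPolynomial σ F →+* F).comp (translate a).toRingHom = eval a :=
    ringHom_ext (fun r => by simp) fun i => by simp
  exact DFunLike.congr_fun h p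

theorem translate_sub_C_eval_mem_idealOfVars (a : σ → F) (p : MvPolynomial σ F) :
    translate a p - C (eval a p) ∈ idealOfVars σ F := by
  rw [← pow_one (idealOfVars σ F), mem_pow_idealOfVars_iff']
  intro x hx
  rw [Nat.lt_one_iff, Finsupp.degree_eq_zero_iff] at hx
  rw [hx, coeff_sub, coeff_zero_C, ← constantCoeff_translate, constantCoeff_eq, sub_self]

theorem aeval_mem_pow_idealOfVars {v : σ → MvPolynomial τ F} (hv : ∀ i, v i ∈ idealOfVars τ F)
    {m : ℕ} {p : MvPolynomial σ F} (hp : p ∈ idealOfVars σ F ^ m) :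
    aeval v p ∈ idealOfVars τ F ^ m := by
  have h : (idealOfVars σ F).map (aeval v) ≤ idealOfVars τ F := by
    rw [idealOfVars, Ideal.map_span, Ideal.span_le]
    rintro _ ⟨_, ⟨i, rfl⟩, rfl⟩
    simpa using hv i
  have h' := Ideal.mem_map_of_mem (aeval v) hp
  rw [Ideal.map_pow] at h'
  exact Ideal.pow_right_mono h m h'

/-- Multiplicities do not drop under substitution. -/
theorem translate_aeval_mem_pow_idealOfVars (v : σ → MvPolynomial τ F) (a : τ → F) {m : ℕ}
    {p : MvPolynomial σ F} (hp : translate (fun i => eval a (v i)) p ∈ idealOfVars σ F ^ m) :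
    translate a (aeval v p) ∈ idealOfVars τ F ^ m := by
  have h : (translate a).comp (aeval v) =
      (aeval fun i => translate a (v i) - C (eval a (v i))).comp
        (translate fun i => eval a (v i)) := by
    refine algHom_ext fun i => ?_
    simp [← algebraMap_eq]
  rw [show translate a (aeval v p) = _ from DFunLike.congr_fun h p]
  exact aeval_mem_pow_idealOfVars (fun i => translate_sub_C_eval_mem_idealOfVars a (v i)) hp

end Order

/-! ### Weighted leading forms -/

section Weighted

variable {σ τ F : Type*} [CommRing F]

/-- The homomorphism `X i ↦ X i * T ^ w i`, whose `k`-th coefficient in the new variable `T` is the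
weighted homogeneous component of degree `k`. -/
noncomputable def weightGrading (w : σ → ℕ) :
    MvPolynomial σ F →ₐ[F] Polynomial (MvPolynomial σ F) :=
  aeval fun i => Polynomial.C (X i) * Polynomial.X ^ w i

theorem weightGrading_monomial (w : σ → ℕ) (e : σ →₀ ℕ) (r : F) :
    weightGrading w (monomial e r) = Polynomial.monomial (Finsupp.weight w e) (monomial e r) := by
  have h1 : weightGrading w (monomial e r) = Polynomial.C (C r) *
      e.prod fun i k => (Polynomial.C (X i) * Polynomial.X ^ w i) ^ k := aeval_monomial _ _ _
  have h2 : (e.prod fun i k => (Polynomial.C (X i : MvPolynomial σ F) * Polynomial.X ^ w i) ^ k) =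
      Polynomial.C (e.prod fun i k => X i ^ k) * Polynomial.X ^ Finsupp.weight w e := by
    simp only [Finsupp.weight_apply, Finsupp.prod, Finsupp.sum, smul_eq_mul, mul_pow,
      Finset.prod_mul_distrib, map_prod, map_pow, ← Finset.prod_pow_eq_pow_sum, ← pow_mul,
      mul_comm (w _)]
  rw [h1, h2, ← mul_assoc, ← Polynomial.C_mul, ← monomial_eq, Polynomial.C_mul_X_pow_eq_monomial]

theorem coeff_weightGrading (w : σ → ℕ) (p : MvPolynomial σ F) (k : ℕ) :
    (weightGrading w p).coeff k = weightedHomogeneousComponent w k p := by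
  classical
  induction p using MvPolynomial.induction_on' with
  | monomial e r =>
    rw [weightGrading_monomial, Polynomial.coeff_monomial]
    split_ifs with h
    · exact ((isWeightedHomogeneous_monomial w e r h).weightedHomogeneousComponent_same).symm
    · exact ((isWeightedHomogeneous_monomial w e r rfl).weightedHomogeneousComponent_ne _
        (Ne.symm h)).symm
  | add p q hp hq => rw [map_add, map_add, Polynomial.coeff_add, hp, hq]

theorem natDegree_weightGrading_le {w : σ → ℕ} {p : MvPolynomial σ F} {k : ℕ} :
    (weightGrading w p).natDegree ≤ k ↔ ∀ e ∈ p.support, Finsupp.weight w e ≤ k := by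
  classical
  rw [Polynomial.natDegree_le_iff_coeff_eq_zero]
  constructor
  · intro h e he
    by_contra! hlt
    have := congrArg (coeff e) (h _ hlt)
    rw [coeff_weightGrading, coeff_weightedHomogeneousComponent, if_pos rfl, coeff_zero] at this
    exact mem_support_iff.1 he this
  · intro h N hN
    rw [coeff_weightGrading]
    exact weightedHomogeneousComponent_eq_zero' _ _ fun e he => ((h e he).trans_lt hN).ne

theorem _root_.Polynomial.natDegree_le_and_coeff_finsuppProd {ι R : Type*} [CommSemiring R]
    {f : ι → Polynomial R} {w : ι → ℕ} (hf : ∀ i, (f i).natDegree ≤ w i) (e : ι →₀ ℕ) :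
    (e.prod fun i k => f i ^ k).natDegree ≤ Finsupp.weight w e ∧
      (e.prod fun i k => f i ^ k).coeff (Finsupp.weight w e) =
        e.prod fun i k => (f i).coeff (w i) ^ k := by
  classical
  simp only [Finsupp.weight_apply, Finsupp.prod, Finsupp.sum, smul_eq_mul]
  induction e.support using Finset.induction_on with
  | empty => simp
  | insert i s hi ih =>
    rw [Finset.prod_insert hi, Finset.prod_insert hi, Finset.sum_insert hi]
    have h1 := Polynomial.natDegree_pow_le_of_le (e i) (hf i)
    refine ⟨Polynomial.natDegree_mul_le_of_le h1 ih.1, ?_⟩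
    rw [Polynomial.coeff_mul_add_eq_of_natDegree_le h1 ih.1, ih.2,
      Polynomial.coeff_pow_of_natDegree_le (hf i)]

/-- If each `v i` has weighted degree at most `w i`, then substituting `v` does not raise the
weighted degree, and the part of highest degree comes from the parts of highest degree. -/
theorem weightGrading_aeval {w : σ → ℕ} {w' : τ → ℕ} {v : σ → MvPolynomial τ F}
    (hv : ∀ i, (weightGrading w' (v i)).natDegree ≤ w i) {P : MvPolynomial σ F} {W : ℕ}
    (hP : ∀ e ∈ P.support, Finsupp.weight w e ≤ W) :
    (weightGrading w' (aeval v P)).natDegree ≤ W ∧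
      weightedHomogeneousComponent w' W (aeval v P) =
        aeval (fun i => weightedHomogeneousComponent w' (w i) (v i))
          (weightedHomogeneousComponent w W P) := by
  classical
  have hmon := Polynomial.natDegree_le_and_coeff_finsuppProd hv
  have hexp : weightGrading w' (aeval v P) = ∑ e ∈ P.support, Polynomial.C (C (coeff e P)) *
      e.prod fun i k => weightGrading w' (v i) ^ k := by
    conv_lhs => rw [P.as_sum]
    simp only [map_sum, aeval_monomial, map_mul]
    refine Finset.sum_congr rfl fun e _ => ?_
    congr 1
    · rw [AlgHom.commutes]
      rfl
    · simp [Finsupp.prod]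
  have hdeg : ∀ e, (Polynomial.C (C (coeff e P)) *
      e.prod fun i k => weightGrading w' (v i) ^ k).natDegree ≤ Finsupp.weight w e := fun e =>
    (Polynomial.natDegree_C_mul_le _ _).trans (hmon e).1
  refine ⟨?_, ?_⟩
  · rw [hexp]
    exact Polynomial.natDegree_sum_le_of_forall_le _ _ fun e he => (hdeg e).trans (hP e he)
  · rw [← coeff_weightGrading, hexp, Polynomial.finsetSum_coeff,
      weightedHomogeneousComponent_apply, map_sum, Finset.sum_filter]
    refine Finset.sum_congr rfl fun e he => ?_
    split_ifs with hW
    · rw [← hW, Polynomial.coeff_C_mul, (hmon e).2, aeval_monomial]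
      simp [coeff_weightGrading, algebraMap_eq]
    · exact Polynomial.coeff_eq_zero_of_natDegree_lt
        ((hdeg e).trans_lt (lt_of_le_of_ne (hP e he) hW))

end Weighted

end MvPolynomial

/-! ### Separating the variables `y` and `x` -/

namespace MvPolynomial

section Sum

variable {σ τ F : Type*} [CommRing F]

theorem sumAlgEquiv_rename_inr (p : MvPolynomial σ F) :
    sumAlgEquiv F τ σ (rename Sum.inr p) = C p :=
  DFunLike.congr_fun (sumAlgEquiv_comp_rename_inr F τ σ) p

theorem coeff_coeff_sumAlgEquiv (p : MvPolynomial (τ ⊕ σ) F) (β : τ →₀ ℕ) (α : σ →₀ ℕ) :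
    coeff α (coeff β (sumAlgEquiv F τ σ p)) = coeff (Finsupp.sumElim β α) p := by
  classical
  induction p using MvPolynomial.induction_on' with
  | add p q hp hq => simp [hp, hq]
  | monomial e r =>
    obtain ⟨e', rfl⟩ := Finsupp.sumFinsuppEquivProdFinsupp.symm.surjective e
    obtain ⟨e₁, e₂⟩ := e'
    have he : Finsupp.sumFinsuppEquivProdFinsupp.symm (e₁, e₂) = Finsupp.sumElim e₁ e₂ := rfl
    have h : sumAlgEquiv F τ σ (monomial (Finsupp.sumElim e₁ e₂) r) =
        monomial e₁ (monomial e₂ r) := by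
      have h1 : monomial (Finsupp.sumElim e₁ e₂) r =
          rename Sum.inl (monomial e₁ (1 : F)) * rename Sum.inr (monomial e₂ r) := by
        rw [rename_monomial, rename_monomial, monomial_mul, one_mul, Finsupp.sumElim_eq_add]
      have h2 : sumAlgEquiv F τ σ (rename Sum.inl (monomial e₁ (1 : F))) = _ :=
        DFunLike.congr_fun (sumAlgEquiv_comp_rename_inl F τ σ) _
      rw [h1, map_mul, h2, sumAlgEquiv_rename_inr]
      simp [algebraMap_eq, mul_comm, C_mul_monomial]
    rw [he, h, coeff_monomial, coeff_monomial]
    by_cases h1 : e₁ = β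
    · subst h1
      simp [coeff_monomial, Finsupp.ext_iff]
    · rw [if_neg h1, if_neg, coeff_zero]
      intro h2
      exact h1 (Finsupp.ext fun i => by simpa using DFunLike.congr_fun h2 (Sum.inl i))

theorem sumAlgEquiv_translate (t : σ → F) (p : MvPolynomial (τ ⊕ σ) F) :
    sumAlgEquiv F τ σ (translate (Sum.elim 0 t) p) =
      map (translate t).toRingHom (sumAlgEquiv F τ σ p) := by
  have hC : ∀ r : F, sumAlgEquiv F τ σ (C r) = C (C r) := sumAlgEquiv_C_inl F τ σ
  let E : MvPolynomial (τ ⊕ σ) F →+* MvPolynomial τ (MvPolynomial σ F) :=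
    RingHomClass.toRingHom (sumAlgEquiv F τ σ)
  have h : E.comp (translate (Sum.elim 0 t)).toRingHom =
      (map (translate t).toRingHom).comp E := by
    refine ringHom_ext (fun r => ?_) fun i => ?_
    · simp [E, hC]
    · cases i with
      | inl i => simp [E]
      | inr j => simp [E, hC]
  exact DFunLike.congr_fun h p

theorem translate_sumAlgEquiv (b : τ → MvPolynomial σ F) (u : τ → MvPolynomial (τ ⊕ σ) F)
    (hu : ∀ i, sumAlgEquiv F τ σ (u i) = C (b i)) (p : MvPolynomial (τ ⊕ σ) F) :
    translate b (sumAlgEquiv F τ σ p) =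
      sumAlgEquiv F τ σ
        (aeval (fun j => Sum.elim (fun i => X (Sum.inl i) + u i) (fun i => X (Sum.inr i)) j) p) := by
  have hC : ∀ r : F, sumAlgEquiv F τ σ (C r) = C (C r) := sumAlgEquiv_C_inl F τ σ
  let E : MvPolynomial (τ ⊕ σ) F →+* MvPolynomial τ (MvPolynomial σ F) :=
    RingHomClass.toRingHom (sumAlgEquiv F τ σ)
  have h : (translate b).toRingHom.comp E = E.comp (aeval fun j =>
      Sum.elim (fun i => X (Sum.inl i) + u i) (fun i => X (Sum.inr i)) j).toRingHom := by
    refine ringHom_ext (fun r => ?_) fun i => ?_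
    · simp [E, hC]
    · cases i with
      | inl i => simp [E, hu]
      | inr j => simp [E]
  exact DFunLike.congr_fun h p

theorem coeff_aeval_C_mul_X (h : τ → F) (p : MvPolynomial τ F) (β : τ →₀ ℕ) :
    coeff β (aeval (fun i => C (h i) * X i) p) = (β.prod fun i k => h i ^ k) * coeff β p := by
  classical
  induction p using MvPolynomial.induction_on' with
  | add p q hp hq => rw [map_add, coeff_add, coeff_add, hp, hq, mul_add]
  | monomial e r =>
    have : aeval (fun i => C (h i) * X i) (monomial e r) =
        monomial e ((e.prod fun i k => h i ^ k) * r) := by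
      rw [aeval_monomial, monomial_eq]
      simp [mul_pow, Finsupp.prod, Finset.prod_mul_distrib, algebraMap_eq]
      ring
    rw [this, coeff_monomial, coeff_monomial]
    split_ifs with h
    · rw [h]
    · simp

/-- Rescaling `y` by `h` trades the polynomial shifts `h i * ρ i` for constant ones, so that the
grid in Schwartz–Zippel can be `F` itself. -/
theorem translate_aeval_C_mul_X (h b : τ → F) (p : MvPolynomial τ F) :
    translate b (aeval (fun i => C (h i) * X i) p) =
      aeval (fun i => C (h i) * X i) (translate (fun i => h i * b i) p) := by
  have : (translate b).comp (aeval fun i => C (h i) * X i) =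
      (aeval fun i => C (h i) * X i).comp (translate fun i => h i * b i) := by
    refine algHom_ext fun i => ?_
    simp [algebraMap_eq, mul_add]
  exact DFunLike.congr_fun this p

theorem weightedHomogeneousComponent_rename_inr (w : τ ⊕ σ → ℕ) (hw : ∀ j, w (Sum.inr j) = 1)
    (k : ℕ) (g : MvPolynomial σ F) :
    weightedHomogeneousComponent w k (rename Sum.inr g) =
      rename Sum.inr (homogeneousComponent k g) := by
  classical
  induction g using MvPolynomial.induction_on' with
  | add p q hp hq => simp only [map_add, hp, hq]
  | monomial e r =>
    have hwt : Finsupp.weight w (e.mapDomain Sum.inr) = e.degree := by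
      rw [Finsupp.weight_apply, Finsupp.sum_mapDomain_index (by simp) (by simp [add_mul])]
      simp [hw, Finsupp.sum, Finsupp.degree_apply]
    have h1 := isWeightedHomogeneous_monomial w (e.mapDomain Sum.inr) r hwt
    have h2 : (monomial e r).IsHomogeneous e.degree := isHomogeneous_monomial r rfl
    rw [rename_monomial]
    by_cases hk : e.degree = k
    · subst hk
      rw [h1.weightedHomogeneousComponent_same, homogeneousComponent_of_mem h2, if_pos rfl,
        rename_monomial]
    · rw [h1.weightedHomogeneousComponent_ne _ (Ne.symm hk), homogeneousComponent_of_mem h2,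
        if_neg (Ne.symm hk), map_zero]

end Sum

end MvPolynomial

/-! ### Multiplicities along graphs -/

namespace MvPolynomial

section BRK

variable {r d : ℕ} {F : Type*} [Field F]

/-- The substitution `(y, x) ↦ a + (y + ρ g(x), x)`, with the `y`-coordinates indexed by `Fin r`. -/
noncomputable def graphSubst (a : Fin r ⊕ Fin d → F) (ρ : Fin r → F)
    (g : Fin r → MvPolynomial (Fin d) F) (j : Fin r ⊕ Fin d) : MvPolynomial (Fin r ⊕ Fin d) F :=
  C (a j) + Sum.elim (fun i => X (Sum.inl i) + C (ρ i) * rename Sum.inr (g i))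
    (fun i => X (Sum.inr i)) j

theorem totalDegree_eq_of_mem_polysWithTop {ℓ : ℕ} {σ : Type*} {h g : MvPolynomial σ F}
    (hh : h.IsHomogeneous ℓ) (h0 : h ≠ 0) (hg : g ∈ polysWithTop h) : g.totalDegree = ℓ := by
  have hg' : homogeneousComponent g.totalDegree g = h := hg
  exact (hg' ▸ homogeneousComponent_isHomogeneous g.totalDegree g).inj_right hh h0

/-- All weights are positive as `ℓ ≥ 1`, so the constants `a j` never reach the top; only the
leading forms of the `g i` do. -/
theorem weightedHomogeneousComponent_graphSubst {ℓ : ℕ} (hℓ : 1 ≤ ℓ)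
    {h : Fin r → MvPolynomial (Fin d) F} (hh : ∀ i, (h i).IsHomogeneous ℓ ∧ h i ≠ 0)
    (a : Fin r ⊕ Fin d → F) (ρ : Fin r → F) {g : Fin r → MvPolynomial (Fin d) F}
    (hg : ∀ i, g i ∈ polysWithTop (h i)) (j : Fin r ⊕ Fin d) :
    (weightGrading (Sum.elim (fun _ => ℓ) fun _ => 1) (graphSubst a ρ g j)).natDegree ≤
        (Sum.elim (fun _ => ℓ) fun _ => 1 : Fin r ⊕ Fin d → ℕ) j ∧
      weightedHomogeneousComponent (Sum.elim (fun _ => ℓ) fun _ => 1)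
        ((Sum.elim (fun _ => ℓ) fun _ => 1 : Fin r ⊕ Fin d → ℕ) j) (graphSubst a ρ g j) =
        Sum.elim (fun i => X (Sum.inl i) + C (ρ i) * rename Sum.inr (h i))
          (fun i => X (Sum.inr i)) j := by
  set w : Fin r ⊕ Fin d → ℕ := Sum.elim (fun _ => ℓ) fun _ => 1 with hw
  have hC : ∀ c : F, ∀ k, k ≠ 0 → weightedHomogeneousComponent w k (C c) = 0 := fun c k hk =>
    (isWeightedHomogeneous_C w c).weightedHomogeneousComponent_ne k hk
  have hX : ∀ j k, k ≠ w j → weightedHomogeneousComponent w k (X j : MvPolynomial _ F) = 0 :=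
    fun j k hk => (isWeightedHomogeneous_X F w j).weightedHomogeneousComponent_ne k hk
  have hX' : ∀ j, weightedHomogeneousComponent w (w j) (X j : MvPolynomial _ F) = X j :=
    fun j => (isWeightedHomogeneous_X F w j).weightedHomogeneousComponent_same
  have hcomp := weightedHomogeneousComponent_rename_inr (F := F) w (fun _ => rfl)
  rw [Polynomial.natDegree_le_iff_coeff_eq_zero]
  simp only [coeff_weightGrading]
  cases j with
  | inl i =>
    have hgi := totalDegree_eq_of_mem_polysWithTop (hh i).1 (hh i).2 (hg i)
    have hgi' : homogeneousComponent ℓ (g i) = h i := by rw [← hgi]; exact hg i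
    refine ⟨fun N hN => ?_, ?_⟩
    · change ℓ < N at hN
      simp only [graphSubst, Sum.elim_inl, map_add, weightedHomogeneousComponent_C_mul]
      rw [hC _ _ (by omega), hX _ _ (by simp [hw]; omega), hcomp,
        homogeneousComponent_eq_zero _ _ (by omega)]
      simp
    · simp only [graphSubst, Sum.elim_inl, map_add, weightedHomogeneousComponent_C_mul]
      rw [hX', hcomp, hC _ _ (by simp [hw]; omega)]
      change _ + (_ + C (ρ i) * rename Sum.inr (homogeneousComponent ℓ (g i))) = _
      rw [hgi', zero_add]
  | inr i =>
    refine ⟨fun N hN => ?_, ?_⟩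
    · change 1 < N at hN
      simp only [graphSubst, Sum.elim_inr, map_add]
      rw [hC _ _ (by omega), hX _ _ (by simp [hw]; omega), zero_add]
    · simp only [graphSubst, Sum.elim_inr, map_add]
      rw [hX', hC _ _ (by simp [hw]), zero_add]

theorem weight_sumElim (ℓ : ℕ) (β : Fin r →₀ ℕ) (α : Fin d →₀ ℕ) :
    Finsupp.weight (Sum.elim (fun _ => ℓ) fun _ => 1) (Finsupp.sumElim β α) =
      ℓ * β.degree + α.degree := by
  simp [Finsupp.weight_eq_sum, Finsupp.degree_eq_sum, Finset.mul_sum, mul_comm]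

theorem degree_sumElim (β : Fin r →₀ ℕ) (α : Fin d →₀ ℕ) :
    (Finsupp.sumElim β α).degree = β.degree + α.degree := by
  simp [Finsupp.degree_eq_sum]

/-- For a nonzero `P` of degree at most `D` some parameter `ρ` has the property that on every graph
`a + (ρ g(t), t)`, where the `g i` have leading forms `h i`, there is a point at which `P` has a
small multiplicity. -/
theorem exists_forall_graph_multiplicity_le [Fintype F] {ℓ : ℕ} (hℓ : 1 ≤ ℓ)
    (hℓq : ℓ ≤ Fintype.card F)
    {h : Fin r → MvPolynomial (Fin d) F} (hh : ∀ i, (h i).IsHomogeneous ℓ ∧ h i ≠ 0)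
    {P : MvPolynomial (Fin r ⊕ Fin d) F} (hP0 : P ≠ 0) :
    ∃ ρ : Fin r → F, ∀ (a : Fin r ⊕ Fin d → F) (g : Fin r → MvPolynomial (Fin d) F),
      (∀ i, g i ∈ polysWithTop (h i)) → ∃ t : Fin d → F, ∀ m,
        translate (a + Sum.elim (fun i => ρ i * eval t (g i)) t) P ∈ idealOfVars _ F ^ m →
        Fintype.card F ^ 2 * m ≤
          P.totalDegree * (Fintype.card F * ℓ + (Fintype.card F - ℓ)) := by
  classical
  set q := Fintype.card F with hq
  set D := P.totalDegree with hD
  set w : Fin r ⊕ Fin d → ℕ := Sum.elim (fun _ => ℓ) fun _ => 1 with hw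
  set W := weightedTotalDegree w P with hW
  have hPdeg : ∀ e ∈ P.support, e.degree ≤ D := fun e he => le_totalDegree he
  have hPW : ∀ e ∈ P.support, Finsupp.weight w e ≤ W := fun e he => le_weightedTotalDegree w he
  set Q := weightedHomogeneousComponent w W P with hQ
  obtain ⟨e₀, he₀, he₀W⟩ : ∃ e ∈ P.support, Finsupp.weight w e = W := by
    obtain ⟨e, he, heW⟩ := P.support.exists_mem_eq_sup (by simpa using hP0) (Finsupp.weight w)
    exact ⟨e, he, heW.symm⟩
  have hWD : W ≤ ℓ * D := by
    obtain ⟨⟨β, α⟩, rfl⟩ := Finsupp.sumFinsuppEquivProdFinsupp.symm.surjective e₀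
    change Finsupp.weight w (Finsupp.sumElim β α) = W at he₀W
    have h1 : (Finsupp.sumElim β α).degree ≤ D := hPdeg _ he₀
    rw [degree_sumElim] at h1
    rw [← he₀W, hw, weight_sumElim]
    nlinarith [Nat.le_mul_of_pos_left α.degree hℓ]
  have hQcoeff : ∀ e, coeff e Q ≠ 0 → coeff e P ≠ 0 := by
    intro e he
    rw [hQ, coeff_weightedHomogeneousComponent] at he
    exact fun h0 => he (by simp [h0])
  have hQ0 : Q ≠ 0 := by
    refine ne_zero_iff.2 ⟨e₀, ?_⟩
    rw [hQ, coeff_weightedHomogeneousComponent, if_pos he₀W]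
    exact mem_support_iff.1 he₀
  set H := sumAlgEquiv F (Fin r) (Fin d) Q with hH
  have hH0 : H ≠ 0 := by simpa [hH] using hQ0
  set G : MvPolynomial (Fin r) (MvPolynomial (Fin d) F) := aeval (fun i => C (h i) * X i) H with hG
  have hG0 : G ≠ 0 := by
    obtain ⟨β, hβ⟩ := ne_zero_iff.1 hH0
    refine ne_zero_iff.2 ⟨β, ?_⟩
    rw [hG, coeff_aeval_C_mul_X]
    exact mul_ne_zero (Finset.prod_ne_zero_iff.2 fun i _ => pow_ne_zero _ (hh i).2) hβ
  have hGdeg : G.totalDegree ≤ D := by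
    refine Finset.sup_le fun β hβ => ?_
    rw [mem_support_iff, hG, coeff_aeval_C_mul_X] at hβ
    obtain ⟨α, hα⟩ := ne_zero_iff.1 (right_ne_zero_of_mul hβ)
    rw [hH, coeff_coeff_sumAlgEquiv] at hα
    have h1 := hPdeg _ (mem_support_iff.2 (hQcoeff _ hα))
    rw [degree_sumElim] at h1
    exact (Nat.le_add_right _ _).trans h1
  have hA : (Finset.univ.image (C : F → MvPolynomial (Fin d) F)).Nonempty := by simp
  -- First use of Schwartz–Zippel, over the domain `F[x]` on a grid of constants. The degree that
  -- counts is that in `y` alone, at most `D`.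
  obtain ⟨ρ', hρ', β, hβ, hβdeg⟩ := exists_coeff_translate_ne_zero hA hG0
  rw [Finset.card_image_of_injective _ (C_injective _ _), Finset.card_univ] at hβdeg
  have hβD : q * β.degree ≤ D := hβdeg.trans hGdeg
  simp only [Finset.mem_image, Finset.mem_univ, true_and] at hρ'
  choose ρ hρ using hρ'
  refine ⟨ρ, fun a g hg => ?_⟩
  rw [hG, translate_aeval_C_mul_X, coeff_aeval_C_mul_X] at hβ
  have hβ' := right_ne_zero_of_mul hβ
  set v := graphSubst a ρ g with hv
  have hvtop := weightedHomogeneousComponent_graphSubst hℓ hh a ρ hg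
  obtain ⟨hdegR, htop⟩ := weightGrading_aeval (fun j => (hvtop j).1) hPW
  set R := aeval v P with hR
  have hTH : translate (fun i => h i * ρ' i) H =
      sumAlgEquiv F (Fin r) (Fin d) (weightedHomogeneousComponent w W R) := by
    have hC : ∀ c : F, sumAlgEquiv F (Fin r) (Fin d) (C c) = C (C c) := sumAlgEquiv_C_inl F _ _
    rw [htop]
    simp only [fun j => (hvtop j).2]
    exact translate_sumAlgEquiv (fun i => h i * ρ' i) (fun i => C (ρ i) * rename Sum.inr (h i))
      (fun i => by rw [map_mul, hC, sumAlgEquiv_rename_inr, ← C_mul, hρ, mul_comm]) Q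
  rw [hTH] at hβ'
  -- The `y^β`-coefficient of the substituted polynomial: nonzero since its top form is, and of
  -- degree at most `W - ℓ|β|` in `x`.
  set f := coeff β (sumAlgEquiv F (Fin r) (Fin d) R) with hf
  have hf0 : f ≠ 0 := by
    obtain ⟨α, hα⟩ := ne_zero_iff.1 hβ'
    rw [coeff_coeff_sumAlgEquiv, coeff_weightedHomogeneousComponent] at hα
    refine ne_zero_iff.2 ⟨α, ?_⟩
    rw [hf, coeff_coeff_sumAlgEquiv]
    exact fun h0 => hα (by simp [h0])
  have hfdeg : f.totalDegree + ℓ * β.degree ≤ W := by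
    have hα : ∀ α ∈ f.support, ℓ * β.degree + α.degree ≤ W := by
      intro α hα
      rw [mem_support_iff, hf, coeff_coeff_sumAlgEquiv] at hα
      rw [← weight_sumElim]
      exact natDegree_weightGrading_le.1 hdegR _ (mem_support_iff.2 hα)
    obtain ⟨α₀, hα₀⟩ := ne_zero_iff.1 hf0
    have h1 := hα α₀ (mem_support_iff.2 hα₀)
    have h2 : f.totalDegree ≤ W - ℓ * β.degree := Finset.sup_le fun α hα' => by
      have := hα α hα'
      change α.degree ≤ _
      omega
    omega
  obtain ⟨t, -, α, hα, hαdeg⟩ := exists_coeff_translate_ne_zero Finset.univ_nonempty hf0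
  rw [Finset.card_univ] at hαdeg
  refine ⟨t, fun m hm => ?_⟩
  have hm' : translate (Sum.elim 0 t) R ∈ idealOfVars _ F ^ m := by
    refine translate_aeval_mem_pow_idealOfVars v _ ?_
    convert hm using 3
    funext j
    cases j <;> simp [hv, graphSubst, eval_rename, Function.comp_def]
  have hcoeff : coeff (Finsupp.sumElim β α) (translate (Sum.elim 0 t) R) ≠ 0 := by
    rw [← coeff_coeff_sumAlgEquiv, sumAlgEquiv_translate, coeff_map]
    exact hα
  have hm'' := (mem_pow_idealOfVars_iff _ _).1 hm' _ (mem_support_iff.2 hcoeff)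
  rw [degree_sumElim] at hm''
  obtain ⟨c, hc⟩ := Nat.exists_eq_add_of_le hℓq
  have hsub : q - ℓ = c := by omega
  rw [hsub]
  have e1 : q * α.degree + ℓ * β.degree ≤ ℓ * D := by
    change q * α.degree ≤ _ at hαdeg
    omega
  have hc' : q = ℓ + c := hc
  -- Combine `q|α| + ℓ|β| ≤ ℓD` with weight `q` and `q|β| ≤ D` with weight `q - ℓ`; this is where `ℓ
  -- ≤ q` enters.
  calc q ^ 2 * m ≤ q ^ 2 * (β.degree + α.degree) := Nat.mul_le_mul_left _ hm''
    _ = q * (q * α.degree + ℓ * β.degree) + c * (q * β.degree) := by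
      rw [hc']; ring
    _ ≤ q * (ℓ * D) + c * D := by gcongr
    _ = D * (q * ℓ + c) := by ring

end BRK

end MvPolynomial

/-! ### Asymptotic count and conclusion -/

theorem Finsupp.pow_le_factorial_mul_card_degree_lt {σ : Type*} [Fintype σ] {D : ℕ} (hD : 0 < D) :
    D ^ Fintype.card σ ≤
      (Fintype.card σ).factorial * (Finsupp.finite_of_degree_lt (σ := σ) D).toFinset.card := by
  obtain ⟨D, rfl⟩ := Nat.exists_eq_add_of_lt hD
  rw [zero_add, Finsupp.factorial_mul_card_degree_lt]
  exact Nat.pow_succ_le_ascFactorial _ _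

theorem Finsupp.factorial_mul_card_degree_lt_le {σ : Type*} [Fintype σ] {D : ℕ} (hD : 0 < D) :
    (Fintype.card σ).factorial * (Finsupp.finite_of_degree_lt (σ := σ) D).toFinset.card ≤
      (D + Fintype.card σ) ^ Fintype.card σ := by
  obtain ⟨D, rfl⟩ := Nat.exists_eq_add_of_lt hD
  rw [zero_add, Finsupp.factorial_mul_card_degree_lt]
  exact (Nat.ascFactorial_le_pow_add _ _).trans (Nat.pow_le_pow_left (by omega) _)

/-- Divide by `k^n` and let `k → ∞`: the error `n` from the monomial count disappears. -/
theorem Nat.pow_le_mul_pow_of_forall_mul {A M n s : ℕ}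
    (h : ∀ k, 0 < k → (A * k) ^ n ≤ s * (M * k + n) ^ n) : A ^ n ≤ s * M ^ n := by
  have hlim : Filter.Tendsto (fun k : ℕ => (s : ℝ) * (M + (n : ℝ) / k) ^ n) Filter.atTop
      (nhds ((s : ℝ) * (M + 0) ^ n)) :=
    ((tendsto_const_nhds.add (tendsto_const_div_atTop_nhds_zero_nat (n : ℝ))).pow n).const_mul _
  have hle : (A : ℝ) ^ n ≤ (s : ℝ) * (M + 0) ^ n := by
    refine ge_of_tendsto hlim (Filter.eventually_atTop.2 ⟨1, fun k hk => ?_⟩)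
    have hk' : (0 : ℝ) < k := by exact_mod_cast hk
    have h1 : ((A : ℝ) * k) ^ n ≤ s * (M * k + n) ^ n := by exact_mod_cast h k hk
    have h2 : (M : ℝ) * k + n = (M + n / k) * k := by field_simp
    rw [h2, mul_pow, mul_pow, ← mul_assoc] at h1
    exact le_of_mul_le_mul_right h1 (pow_pos hk' n)
  rw [add_zero] at hle
  exact_mod_cast hle

/-- For `ℓ ≤ q` one has the stronger bound `q ^ n / (ℓ + 1 - ℓ / q) ^ n ≤ |S|`. -/
theorem IsBRKType.pow_le_ncard_mul_pow {F : Type*} [Field F] [Fintype F] {n d ℓ : ℕ} (hdn : d ≤ n)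
    (hℓ : 1 ≤ ℓ) (hℓq : ℓ ≤ Fintype.card F) {S : Set (Fin n → F)} (hS : IsBRKType n d ℓ S) :
    (Fintype.card F ^ 2) ^ n ≤
      S.ncard * (Fintype.card F * ℓ + (Fintype.card F - ℓ)) ^ n := by
  classical
  obtain ⟨h, hh, hS⟩ := hS
  set q := Fintype.card F with hq
  have hq0 : 0 < q := Fintype.card_pos
  set M := q * ℓ + (q - ℓ) with hM
  have hM0 : 0 < M := by positivity
  let κ : Fin (n - d) ⊕ Fin d ≃ Fin n :=
    (Equiv.sumComm _ _).trans (finSumFinEquiv.trans (finCongr (by omega)))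
  let S' : Finset (Fin (n - d) ⊕ Fin d → F) := S.toFinset.image fun x => x ∘ κ
  have hcardS' : S'.card = S.ncard := by
    rw [Finset.card_image_of_injective _ κ.surjective.injective_comp_right,
      Set.ncard_eq_toFinset_card']
  have hcard : Fintype.card (Fin (n - d) ⊕ Fin d) = n := by simp; omega
  rw [← hcardS']
  refine Nat.pow_le_mul_pow_of_forall_mul fun k hk => ?_
  have hle : (Finsupp.finite_of_degree_lt (σ := Fin (n - d) ⊕ Fin d) (q ^ 2 * k)).toFinset.card ≤
      S'.card * (Finsupp.finite_of_degree_lt (σ := Fin (n - d) ⊕ Fin d) (M * k)).toFinset.card := by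
    by_contra! hlt
    obtain ⟨P, hP0, hPdeg, hP⟩ :=
      MvPolynomial.exists_ne_zero_translate_mem_pow_idealOfVars S' _ _ hlt
    obtain ⟨ρ, hρ⟩ := MvPolynomial.exists_forall_graph_multiplicity_le hℓ hℓq hh hP0
    obtain ⟨a, g, hg, hag⟩ := hS ρ
    obtain ⟨t, ht⟩ := hρ (a ∘ κ) g hg
    have hpt : brkPoint a ρ g t ∘ κ =
        a ∘ κ + Sum.elim (fun i => ρ i * MvPolynomial.eval t (g i)) t := by
      funext j
      cases j <;> simp [brkPoint, κ]
    have hmul := ht (M * k) (by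
      rw [← hpt]
      exact hP _ (Finset.mem_image_of_mem _ (Set.mem_toFinset.2 (hag ⟨t, rfl⟩))))
    change q ^ 2 * (M * k) ≤ P.totalDegree * M at hmul
    have := Nat.mul_lt_mul_of_pos_right hPdeg hM0
    nlinarith
  have h1 := Finsupp.pow_le_factorial_mul_card_degree_lt (σ := Fin (n - d) ⊕ Fin d)
    (D := q ^ 2 * k) (by positivity)
  have h2 := Finsupp.factorial_mul_card_degree_lt_le (σ := Fin (n - d) ⊕ Fin d)
    (D := M * k) (by positivity)
  rw [hcard] at h1 h2
  calc (q ^ 2 * k) ^ n ≤ _ := h1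
    _ ≤ n.factorial * _ := Nat.mul_le_mul_left _ hle
    _ = S'.card * (n.factorial * _) := by ring
    _ ≤ S'.card * (M * k + n) ^ n := Nat.mul_le_mul_left _ h2

theorem theorem1p4 {F : Type*} [Field F] [Fintype F] (n d ℓ : ℕ) (hd : 1 ≤ d) (hdn : d < n)
    (hℓ : 1 ≤ ℓ) (S : Set (Fin n → F)) (hS : IsBRKType n d ℓ S) :
    ((Fintype.card F : ℝ) - 1) ^ n
        / ((ℓ : ℝ) + 1 - 2 * (ℓ : ℝ) / (Fintype.card F : ℝ)) ^ n ≤ (S.ncard : ℝ) := by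
  have hq2 : 2 ≤ Fintype.card F := Fintype.one_lt_card
  have hq : (2 : ℝ) ≤ Fintype.card F := by exact_mod_cast hq2
  have hℓ' : (1 : ℝ) ≤ ℓ := by exact_mod_cast hℓ
  have hden : (0 : ℝ) < ℓ + 1 - 2 * ℓ / Fintype.card F := by
    have : 2 * (ℓ : ℝ) / Fintype.card F ≤ ℓ := by
      rw [div_le_iff₀ (by linarith)]
      nlinarith
    linarith
  rw [← div_pow]
  rcases le_total ℓ (Fintype.card F) with hℓq | hℓq
  · have hmain := hS.pow_le_ncard_mul_pow hdn.le hℓ hℓq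
    have hmain' : ((Fintype.card F : ℝ) ^ 2) ^ n ≤
        S.ncard * (Fintype.card F * ℓ + (Fintype.card F - ℓ)) ^ n := by
      have := (Nat.cast_le (α := ℝ)).2 hmain
      push_cast [hℓq] at this
      exact this
    have hℓqR : (ℓ : ℝ) ≤ Fintype.card F := by exact_mod_cast hℓq
    generalize (Fintype.card F : ℝ) = q at *
    have hM : 0 < q * ℓ + (q - ℓ) := by nlinarith
    rw [← div_le_iff₀ (pow_pos hM n), ← div_pow] at hmain'
    refine le_trans (pow_le_pow_left₀ (div_nonneg (by linarith) hden.le) ?_ n) hmain'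
    -- After clearing denominators the two sides differ by exactly `q - ℓ`.
    rw [div_le_div_iff₀ hden hM]
    have : q ^ 2 * (ℓ + 1 - 2 * ℓ / q) = q * (q * ℓ + q - 2 * ℓ) := by
      field_simp
    rw [this]
    nlinarith
  · have hne : S.Nonempty := by
      obtain ⟨h, -, hS⟩ := hS
      obtain ⟨a, g, -, hag⟩ := hS 0
      exact ⟨_, hag ⟨0, rfl⟩⟩
    have hone : (1 : ℝ) ≤ S.ncard := by exact_mod_cast (Set.ncard_pos S.toFinite).2 hne
    refine le_trans (pow_le_one₀ (div_nonneg (by linarith) hden.le) ?_) hone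
    -- Since `2 / q ≤ 1` and `ℓ ≥ q`, one has `ℓ(1 - 2/q) + 1 ≥ q - 1`.
    rw [div_le_one hden]
    have hℓqR : (Fintype.card F : ℝ) ≤ ℓ := by exact_mod_cast hℓq
    generalize (Fintype.card F : ℝ) = q at *
    have : 2 * (ℓ : ℝ) / q = ℓ * (2 / q) := by ring
    have h3 : 2 / q ≤ 1 := by rw [div_le_one (by linarith)]; exact hq
    have h4 : q * (2 / q) = 2 := by field_simp
    rw [this]
    nlinarith
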